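/- Let $A$ be a finite alphabet, $p\ge 2$, and let $\tau:A\to A^p$ be a substitution of constant length $p$, extended by concatenation to finite words and to $A^{\mathbb Z}$ (with $\tau(x_0)$ starting at coordinate $0$). Assume that $\tau$ is primitive, i.e. there is $n\ge 0$ such that every letter $a$ occurs in $\tau^n(b)$ for every letter $b$. Let $T$ be the shift on $A^{\mathbb Z}$, $(Tx)_i=x_{i+1}$, and let $X_\tau\subseteq A^{\mathbb Z}$ be the smallest closed set with $TX_\tau=X_\tau$ in which all words $\tau^n(a)$ ($n\ge 0$, $a\in A$) appear. Assume that $X_\tau$ is infinite. Then for each $x\in X_\tau$ there is a unique sequence $\pi(x)=(\delta_i)_{i\ge 0}\in\{0,\dots,p-1\}^{\mathbb N}$ for which there exist points $x^{(i)}\in X_\tau$ with $x^{(0)}=x$ and $\tau(x^{(i+1)})=T^{-\delta_i}x^{(i)}$ for all $i\ge 0$ (a known theorem of Dekking and Mossé, recalled here only to define $\pi$); through base-$p$ expansions, $\pi$ is the factor map of $X_\tau$ onto the $p$-odometer. **Proposition 3.3.** If $\tau$ has overall coincidences, that is, for all $a,b\in A$ there is $i\in\{0,\dots,p-1\}$ with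 $\tau(a)_i=\tau(b)_i$, then any two distinct points $x,y\in X_\tau$ with $\pi(x)=\pi(y)$ form a proximal pair: for every metric $\rho$ on $X_\tau$ inducing its topology (the subspace topology from the product of the discrete topologies), $$\liminf_{n\to\infty}\rho(T^nx,T^ny)=0 .$$ -/

import Mathlib

namespace ConstSubst

/-- The power `T ^ k` (`k ∈ ℤ`) of the two-sided shift on `A ^ ℤ`: `(T ^ k x)_n = x_{n + k}`. -/
def shiftPow {A : Type*} (k : ℤ) (x : ℤ → A) : ℤ → A := fun n => x (n + k)

/-- The two-sided shift map `T`: `(T x)_n = x_{n + 1}`. -/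
def shift {A : Type*} (x : ℤ → A) : ℤ → A := fun n => x (n + 1)

/-- A two-sided subshift: a closed subset `X` of `A ^ ℤ` (product of the discrete topologies)
with `T X = X`. -/
def IsSubshift {A : Type*} [TopologicalSpace A] (X : Set (ℤ → A)) : Prop :=
  IsClosed X ∧ shift '' X = X

/-- The finite word `w` is a sub-word of the two-sided sequence `x`. -/
def Occurs {A : Type*} (w : List A) (x : ℤ → A) : Prop :=
  ∃ k : ℤ, ∀ (i : ℕ) (hi : i < w.length), x (k + i) = w[i]

/-- A word appears in a set of sequences if it is a sub-word of one of its points. -/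
def AppearsIn {A : Type*} (w : List A) (X : Set (ℤ → A)) : Prop :=
  ∃ x ∈ X, Occurs w x

/-! A substitution of constant length `p` on the alphabet `A` is a map `τ : A → Fin p → A`, the
image of the letter `a` being the word `τ a 0, …, τ a (p - 1)`. -/

/-- Extension of a substitution to finite words, by concatenation. -/
def substWord {A : Type*} {p : ℕ} (τ : A → Fin p → A) (w : List A) : List A :=
  w.flatMap fun a => List.ofFn (τ a)

/-- The word `τ ^ n (a)`. -/
def iterWord {A : Type*} {p : ℕ} (τ : A → Fin p → A) (n : ℕ) (a : A) : List A :=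
  (substWord τ)^[n] [a]

/-- Extension of a substitution to two-sided sequences, by concatenation, the word `τ (x_0)`
starting at coordinate `0`: the letter at coordinate `p * k + i`, `0 ≤ i < p`, is the `i`-th letter
of `τ (x_k)`. -/
def substSeq {A : Type*} {p : ℕ} [NeZero p] (τ : A → Fin p → A) (x : ℤ → A) : ℤ → A :=
  fun n => τ (x (n / p)) (Fin.ofNat p (n % p).toNat)

/-- Primitivity: for some `n`, every letter `a` appears in every word `τ ^ n (b)`. -/
def IsPrimitive {A : Type*} {p : ℕ} (τ : A → Fin p → A) : Prop :=
  ∃ n : ℕ, ∀ a b : A, a ∈ iterWord τ n b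

/-- Two words of the same length have a coincidence if they agree at some coordinate. -/
def HaveCoincidence {A : Type*} {n : ℕ} (u v : Fin n → A) : Prop :=
  ∃ i : Fin n, u i = v i

/-- The images of any two letters have a coincidence. -/
def HasOverallCoincidences {A : Type*} {p : ℕ} (τ : A → Fin p → A) : Prop :=
  ∀ a b : A, HaveCoincidence (τ a) (τ b)

/-- `X_τ`: the smallest subshift of `A ^ ℤ` in which all the words `τ ^ n (a)` appear. -/
def substShift {A : Type*} [TopologicalSpace A] {p : ℕ} (τ : A → Fin p → A) : Set (ℤ → A) :=
  ⋂₀ {X | IsSubshift X ∧ ∀ (n : ℕ) (a : A), AppearsIn (iterWord τ n a) X}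

theorem shift_mem_substShift {A : Type*} [TopologicalSpace A] {p : ℕ} (τ : A → Fin p → A)
    {x : ℤ → A} (hx : x ∈ substShift τ) : shift x ∈ substShift τ := by
  intro X hX
  rw [← hX.1.2]
  exact ⟨x, hx X hX, rfl⟩

/-- The action on `X_τ`: the restriction of the shift. -/
def shiftOn {A : Type*} [TopologicalSpace A] {p : ℕ} (τ : A → Fin p → A)
    (x : substShift τ) : substShift τ :=
  ⟨shift x.1, shift_mem_substShift τ x.2⟩

/-- `δ ∈ {0, …, p - 1} ^ ℕ` is an odometer address of `x ∈ X_τ`: there are points `x^(i)` of `X_τ`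
with `x^(0) = x` and `τ (x^(i+1)) = T ^ (-δ_i) x^(i)` for all `i`. -/
def IsAddress {A : Type*} [TopologicalSpace A] {p : ℕ} [NeZero p] (τ : A → Fin p → A)
    (x : substShift τ) (δ : ℕ → Fin p) : Prop :=
  ∃ z : ℕ → substShift τ, z 0 = x ∧
    ∀ i : ℕ, substSeq τ (z (i + 1)).1 = shiftPow (-((δ i : ℕ) : ℤ)) (z i).1

/-- The factor map `π` from `X_τ` to the `p`-odometer, the latter identified with
`{0, …, p - 1} ^ ℕ` through expansion in base `p`: `π x` is the address of `x` (there is exactly one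
if `τ` is primitive and `X_τ` is infinite). -/
noncomputable def odometerMap {A : Type*} [TopologicalSpace A] {p : ℕ} [NeZero p]
    (τ : A → Fin p → A) (x : substShift τ) : ℕ → Fin p :=
  Classical.epsilon fun δ => IsAddress τ x δ

/-- Proximality of the pair `x, y` for the map `T` and the distance `ρ`:
`liminf ρ (T ^ n x, T ^ n y) = 0` as `n → +∞`. -/
def IsProximalPair {X : Type*} (ρ : X → X → ℝ) (T : X → X) (x y : X) : Prop :=
  Filter.liminf (fun n : ℕ => ρ (T^[n] x) (T^[n] y)) Filter.atTop = 0

end ConstSubst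

/-! If `δ` is the address of `x`, then `x = T ^ δ_0 τ (x')`, where `x'` has the shifted address.
Let `x` and `y` share their address. By the overall coincidences `τ (x')` and `τ (y')` have a letter
in common in every block of length `p`; and a common word of length `n` of `x'` and `y'` at
coordinate `k` becomes a common word of length `p n` of `x` and `y` at coordinate `p k - δ_0`. By
induction `x` and `y` agree on arbitrarily long words arbitrarily far to the right.

That every point has an address follows from `X_τ ⊆ Y`, where `Y` is the union of the sets
`T ^ d τ (X_τ)` for `d < p`. As `Y` is a subshift, by minimality of `X_τ` it suffices that the words
`τ ^ n (a)` appear in `Y`, and by primitivity that they appear in `X_τ`. To see this, take a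
sequence all of whose sub-words are sub-words of some `τ ^ n (a)`; it exists by compactness, and it
and its images under `τ` lie in every subshift in which the words `τ ^ n (a)` appear. -/

namespace ConstSubst

open Filter Topology

variable {A : Type*} {p : ℕ}

section Window

/-- The word of length `n` of the sequence `x` that starts at coordinate `k`. -/
def window (x : ℤ → A) (k : ℤ) (n : ℕ) : List A := List.ofFn fun i : Fin n => x (k + i)

@[simp]
theorem length_window (x : ℤ → A) (k : ℤ) (n : ℕ) : (window x k n).length = n :=
  List.length_ofFn

@[simp]
theorem getElem_window (x : ℤ → A) (k : ℤ) {n i : ℕ} (hi : i < (window x k n).length) :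
    (window x k n)[i] = x (k + i) :=
  List.getElem_ofFn hi

theorem window_one (x : ℤ → A) (k : ℤ) : window x k 1 = [x k] := by
  simp [window]

theorem window_add (x : ℤ → A) (k : ℤ) (m n : ℕ) :
    window x k (m + n) = window x k m ++ window x (k + m) n := by
  simp [window, List.ofFn_add, add_assoc]

theorem window_shiftPow (j : ℤ) (x : ℤ → A) (k : ℤ) (n : ℕ) :
    window (shiftPow j x) k n = window x (k + j) n := by
  simp only [window, shiftPow, add_right_comm]

theorem window_isInfix_window (x : ℤ → A) {j k : ℤ} {m n : ℕ} (hjk : j ≤ k)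
    (hkj : k + n ≤ j + m) : window x k n <:+: window x j m := by
  obtain ⟨a, rfl⟩ := Int.le.dest hjk
  obtain ⟨b, rfl⟩ : ∃ b : ℕ, m = a + n + b := Nat.exists_eq_add_of_le (by omega)
  rw [window_add, window_add]
  exact List.infix_append _ _ _

theorem window_eq_window_iff {x y : ℤ → A} {k : ℤ} {n : ℕ} :
    window x k n = window y k n ↔ ∀ i, k ≤ i → i < k + n → x i = y i := by
  rw [window, window, List.ofFn_inj, funext_iff]
  refine ⟨fun h i hki hik => ?_, fun h i => h _ (by omega) (by omega)⟩
  obtain ⟨j, rfl⟩ := Int.le.dest hki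
  exact h ⟨j, by omega⟩

theorem exists_window_eq [Nonempty A] (w : List A) (k : ℤ) :
    ∃ x : ℤ → A, window x k w.length = w :=
  ⟨fun i => w.getD (i - k).toNat (Classical.arbitrary A),
    List.ext_getElem (length_window _ _ _) fun i _ hi => by simp [hi]⟩

theorem isClosed_setOf_window_mem [TopologicalSpace A] [DiscreteTopology A] (k : ℤ) (n : ℕ)
    (S : Set (List A)) : IsClosed {x : ℤ → A | window x k n ∈ S} :=
  (isClosed_discrete {f : Fin n → A | List.ofFn f ∈ S}).preimage
    (f := fun (x : ℤ → A) (i : Fin n) => x (k + i)) (by fun_prop)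

theorem occurs_iff_exists_window_eq {w : List A} {x : ℤ → A} :
    Occurs w x ↔ ∃ k, window x k w.length = w := by
  refine exists_congr fun k => ⟨fun h => List.ext_getElem (length_window _ _ _) ?_, ?_⟩
  · intro i _ hi
    rw [getElem_window, h i hi]
  · intro h i hi
    simp only [← getElem_window x k (by simpa using hi), h]

theorem Occurs.of_isInfix {v w : List A} {x : ℤ → A} (h : Occurs w x) (hvw : v <:+: w) :
    Occurs v x := by
  obtain ⟨s, t, rfl⟩ := hvw
  obtain ⟨k, hk⟩ := h
  refine ⟨k + s.length, fun i hi => ?_⟩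
  have := hk (s.length + i) (by simp; omega)
  simpa [List.getElem_append, hi, add_assoc] using this

theorem AppearsIn.of_isInfix {v w : List A} {X : Set (ℤ → A)} (h : AppearsIn w X)
    (hvw : v <:+: w) : AppearsIn v X :=
  h.imp fun _ hx => ⟨hx.1, hx.2.of_isInfix hvw⟩

end Window

section Subshift

theorem shiftPow_shiftPow (j k : ℤ) (x : ℤ → A) :
    shiftPow j (shiftPow k x) = shiftPow (j + k) x := by
  funext n
  simp only [shiftPow, add_assoc]

theorem shiftPow_zero (x : ℤ → A) : shiftPow 0 x = x := by
  funext n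
  simp only [shiftPow, add_zero]

theorem shift_eq_shiftPow (x : ℤ → A) : shift x = shiftPow 1 x := rfl

theorem shift_iterate (n : ℕ) (x : ℤ → A) : shift^[n] x = shiftPow n x := by
  induction n with
  | zero => exact (shiftPow_zero x).symm
  | succ n ih =>
    rw [Function.iterate_succ_apply', ih, shift_eq_shiftPow, shiftPow_shiftPow, add_comm,
      Nat.cast_succ]

variable [TopologicalSpace A]

theorem continuous_shiftPow (k : ℤ) : Continuous (shiftPow k : (ℤ → A) → ℤ → A) :=
  continuous_pi fun n => continuous_apply (n + k)

theorem IsSubshift.shiftPow_mem {X : Set (ℤ → A)} (hX : IsSubshift X) {x : ℤ → A} (hx : x ∈ X)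
    (k : ℤ) : shiftPow k x ∈ X := by
  induction k with
  | zero => rwa [shiftPow_zero]
  | succ k ih =>
    rw [add_comm, ← shiftPow_shiftPow, ← hX.2]
    exact ⟨_, ih, rfl⟩
  | pred k ih =>
    rw [← hX.2] at ih
    obtain ⟨y, hy, hyx⟩ := ih
    rwa [sub_eq_neg_add, ← shiftPow_shiftPow, ← hyx, shift_eq_shiftPow, shiftPow_shiftPow,
      neg_add_cancel, shiftPow_zero]

theorem isSubshift_iff {X : Set (ℤ → A)} :
    IsSubshift X ↔ IsClosed X ∧ ∀ x ∈ X, ∀ k, shiftPow k x ∈ X := by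
  refine ⟨fun hX => ⟨hX.1, fun x hx => hX.shiftPow_mem hx⟩, fun ⟨hX, h⟩ => ⟨hX, ?_⟩⟩
  refine Set.Subset.antisymm (Set.image_subset_iff.2 fun x hx => h x hx 1) fun x hx =>
    ⟨shiftPow (-1) x, h x hx _, ?_⟩
  rw [shift_eq_shiftPow, shiftPow_shiftPow, add_neg_cancel, shiftPow_zero]

theorem IsSubshift.mem_of_forall_appearsIn {X : Set (ℤ → A)} (hX : IsSubshift X) {x : ℤ → A}
    (h : ∀ k n, AppearsIn (window x k n) X) : x ∈ X := by
  have approx (L : ℕ) : ∃ y ∈ X, window y (-L) (2 * L) = window x (-L) (2 * L) := by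
    obtain ⟨y, hy, hxy⟩ := h (-L) (2 * L)
    obtain ⟨k, hk⟩ := occurs_iff_exists_window_eq.1 hxy
    refine ⟨shiftPow (k + L) y, hX.shiftPow_mem hy _, ?_⟩
    rw [length_window] at hk
    rw [window_shiftPow, neg_add_cancel_comm_assoc, hk]
  choose y hy hyx using approx
  refine hX.1.mem_of_tendsto (b := atTop) (tendsto_pi_nhds.2 fun i => ?_) (Eventually.of_forall hy)
  refine tendsto_const_nhds.congr' ?_
  filter_upwards [eventually_gt_atTop i.natAbs] with L hL
  exact (window_eq_window_iff.1 (hyx L) i (by omega) (by omega)).symm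

variable (τ : A → Fin p → A)

theorem isClosed_substShift : IsClosed (substShift τ) :=
  isClosed_sInter fun _ hX => hX.1.1

theorem isSubshift_substShift : IsSubshift (substShift τ) :=
  isSubshift_iff.2
    ⟨isClosed_substShift τ, fun _ hx k X hX => hX.1.shiftPow_mem (hx X hX) k⟩

theorem coe_shiftOn_iterate (n : ℕ) (x : substShift τ) :
    ((shiftOn τ)^[n] x).1 = shiftPow n x.1 := by
  rw [← shift_iterate]
  exact (Function.Semiconj.iterate_right (f := Subtype.val) (fun _ => rfl) n).eq x

end Subshift

section Substitution

variable {τ : A → Fin p → A}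

theorem iterWord_succ (n : ℕ) (a : A) : iterWord τ (n + 1) a = substWord τ (iterWord τ n a) :=
  Function.iterate_succ_apply' _ _ _

theorem length_iterWord (n : ℕ) (a : A) : (iterWord τ n a).length = p ^ n := by
  induction n with
  | zero => rfl
  | succ n ih => simp [iterWord_succ, substWord, List.length_flatMap, ih, pow_succ]

theorem iterWord_isInfix {m : ℕ} {a b : A} (h : a ∈ iterWord τ m b) (n : ℕ) :
    iterWord τ n a <:+: iterWord τ (n + m) b := by
  induction n with
  | zero => simpa [iterWord, List.singleton_infix_iff] using h
  | succ n ih =>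
    rw [Nat.add_right_comm, iterWord_succ, iterWord_succ]
    exact ih.flatMap _

variable [NeZero p]

theorem substSeq_mul_add (x : ℤ → A) (k : ℤ) (i : Fin p) :
    substSeq τ x (p * k + i) = τ (x k) i := by
  have hp : (p : ℤ) ≠ 0 := mod_cast NeZero.ne p
  have hi : ((i : ℕ) : ℤ) < p := mod_cast i.2
  have hdiv : ((p : ℤ) * k + i) / p = k := by
    rw [Int.mul_add_ediv_left _ _ hp, Int.ediv_eq_zero_of_lt (by positivity) hi, add_zero]
  have hmod : ((p : ℤ) * k + i) % p = i := by
    rw [Int.mul_add_emod_self_left, Int.emod_eq_of_lt (by positivity) hi]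
  rw [substSeq, hdiv, hmod, Int.toNat_natCast, Fin.ofNat_eq_cast, Fin.cast_val_eq_self]

theorem substSeq_shiftPow (k : ℤ) (x : ℤ → A) :
    substSeq τ (shiftPow k x) = shiftPow (p * k) (substSeq τ x) := by
  have hp : (p : ℤ) ≠ 0 := mod_cast NeZero.ne p
  funext n
  simp only [substSeq, shiftPow]
  rw [Int.add_mul_ediv_left _ _ hp, Int.add_mul_emod_self_left]

theorem substWord_window (x : ℤ → A) (k : ℤ) (n : ℕ) :
    substWord τ (window x k n) = window (substSeq τ x) (p * k) (p * n) := by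
  have hτ (i : Fin n) (j : Fin p) : τ (x (k + i)) j =
      substSeq τ x (p * k + (p * i + j : ℕ)) := by
    rw [← substSeq_mul_add (τ := τ)]
    push_cast
    ring_nf
  simp only [substWord, window, List.ofFn_mul', List.flatMap_def, List.map_ofFn,
    Function.comp_def, ← hτ]

theorem Occurs.substWord {w : List A} {x : ℤ → A} (h : Occurs w x) :
    Occurs (substWord τ w) (substSeq τ x) := by
  obtain ⟨k, hk⟩ := occurs_iff_exists_window_eq.1 h
  rw [← hk, substWord_window]
  exact occurs_iff_exists_window_eq.2 ⟨p * k, by rw [length_window]⟩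

theorem IsPrimitive.exists_iterWord_isInfix_succ (hprim : IsPrimitive τ) (n : ℕ) (a b : A) :
    ∃ m, iterWord τ n a <:+: iterWord τ (m + 1) b := by
  obtain ⟨N, hN⟩ := hprim
  have hmem : τ b 0 ∈ iterWord τ 1 b := by
    simp [iterWord, substWord]
  exact ⟨n + N, (iterWord_isInfix (hN a (τ b 0)) n).trans (iterWord_isInfix hmem (n + N))⟩

theorem continuous_substSeq [TopologicalSpace A] [DiscreteTopology A] :
    Continuous (substSeq τ) :=
  continuous_pi fun n =>
    (continuous_of_discreteTopology (f := fun a => τ a (Fin.ofNat p (n % p).toNat))).comp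
      (continuous_apply (n / p))

end Substitution

section Language

variable (τ : A → Fin p → A)

/-- The language of a substitution: the words that are sub-words of some `τ ^ n (a)`. -/
def language : Set (List A) := {w | ∃ n a, w <:+: iterWord τ n a}

/-- The sequences all of whose sub-words belong to the language of `τ`. They provide points of
`X_τ`, which is itself only given as an intersection. -/
def languageShift : Set (ℤ → A) := {x | ∀ k n, window x k n ∈ language τ}

variable {τ}

theorem mem_language_of_isInfix {v w : List A} (hvw : v <:+: w) (hw : w ∈ language τ) :
    v ∈ language τ :=
  let ⟨n, a, h⟩ := hw
  ⟨n, a, hvw.trans h⟩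

theorem substWord_mem_language {w : List A} (hw : w ∈ language τ) :
    substWord τ w ∈ language τ :=
  let ⟨n, a, h⟩ := hw
  ⟨n + 1, a, iterWord_succ (τ := τ) n a ▸ h.flatMap _⟩

theorem languageShift_eq_iInter :
    languageShift τ = ⋂ L : ℕ, {x | window x (-L) (2 * L) ∈ language τ} := by
  refine Set.Subset.antisymm (fun x hx => Set.mem_iInter.2 fun L => hx _ _) fun x hx k n => ?_
  exact mem_language_of_isInfix (window_isInfix_window x (by omega) (by omega))
    (Set.mem_iInter.1 hx (k.natAbs + n))

theorem languageShift_nonempty [Finite A] [Nonempty A] (hp : 2 ≤ p) :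
    (languageShift τ).Nonempty := by
  let _ : TopologicalSpace A := ⊥
  have : DiscreteTopology A := ⟨rfl⟩
  have hclosed (L : ℕ) : IsClosed {x : ℤ → A | window x (-L) (2 * L) ∈ language τ} :=
    isClosed_setOf_window_mem _ _ _
  rw [languageShift_eq_iInter]
  refine IsCompact.nonempty_iInter_of_sequence_nonempty_isCompact_isClosed _ (fun L x hx => ?_)
    (fun L => ?_) (hclosed 0).isCompact hclosed
  · exact mem_language_of_isInfix (window_isInfix_window x (by omega) (by omega)) hx
  · let w := iterWord τ (2 * L) (Classical.arbitrary A)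
    have hw : 2 * L ≤ w.length := by
      rw [length_iterWord]
      exact (Nat.lt_pow_self hp).le
    obtain ⟨x, hx⟩ := exists_window_eq w (-L)
    have hinfix : window x (-L) (2 * L) <:+: window x (-L) w.length :=
      window_isInfix_window x le_rfl (by omega)
    exact ⟨x, _, _, hx ▸ hinfix⟩

theorem languageShift_subset_substShift [TopologicalSpace A] :
    languageShift τ ⊆ substShift τ := by
  rintro x hx X ⟨hX, hword⟩
  refine hX.mem_of_forall_appearsIn fun k n => ?_
  obtain ⟨m, a, h⟩ := hx k n
  exact (hword m a).of_isInfix h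

variable [NeZero p]

theorem substSeq_mem_languageShift {x : ℤ → A} (hx : x ∈ languageShift τ) :
    substSeq τ x ∈ languageShift τ := by
  intro k n
  have hp : (0 : ℤ) < p := mod_cast NeZero.pos p
  have hleft : p * (k / p) ≤ k := Int.mul_ediv_self_le hp.ne'
  have hright : k + n ≤ p * (k / p) + (p * (n + 1) : ℕ) := by
    have := Int.lt_mul_ediv_self_add (x := k) hp
    push_cast
    nlinarith
  refine mem_language_of_isInfix (window_isInfix_window _ hleft hright) ?_
  rw [← substWord_window]
  exact substWord_mem_language (hx _ _)

theorem appearsIn_iterWord_languageShift {x : ℤ → A} (hx : x ∈ languageShift τ) (n : ℕ) :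
    AppearsIn (iterWord τ n (x 0)) (languageShift τ) := by
  induction n with
  | zero => exact ⟨x, hx, 0, by simp [iterWord]⟩
  | succ n ih =>
    obtain ⟨y, hy, h⟩ := ih
    rw [iterWord_succ]
    exact ⟨substSeq τ y, substSeq_mem_languageShift hy, h.substWord⟩

theorem appearsIn_iterWord_substShift [Finite A] [TopologicalSpace A] (hp : 2 ≤ p)
    (hprim : IsPrimitive τ) (n : ℕ) (a : A) : AppearsIn (iterWord τ n a) (substShift τ) := by
  have : Nonempty A := ⟨a⟩
  obtain ⟨x, hx⟩ := languageShift_nonempty (τ := τ) hp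
  obtain ⟨m, hm⟩ := hprim.exists_iterWord_isInfix_succ n a (x 0)
  obtain ⟨y, hy, h⟩ := (appearsIn_iterWord_languageShift hx (m + 1)).of_isInfix hm
  exact ⟨y, languageShift_subset_substShift hy, h⟩

end Language

section Address

variable [NeZero p]

/-- The union of the translates of `τ (X)`: the subshift generated by `τ (X)` when `X` is a
subshift. The translates by `0, …, p - 1` suffice, since `T ^ p τ = τ T`. -/
def substHull (τ : A → Fin p → A) (X : Set (ℤ → A)) : Set (ℤ → A) :=
  ⋃ d : Fin p, (fun z => shiftPow (d : ℕ) (substSeq τ z)) '' X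

variable [TopologicalSpace A] {τ : A → Fin p → A} {X : Set (ℤ → A)}

theorem shiftPow_substSeq_mem_substHull (hX : IsSubshift X) {z : ℤ → A} (hz : z ∈ X) (k : ℤ) :
    shiftPow k (substSeq τ z) ∈ substHull τ X := by
  have hp : (0 : ℤ) < p := mod_cast NeZero.pos p
  have hnonneg : 0 ≤ k % p := Int.emod_nonneg k hp.ne'
  have hlt : k % p < p := Int.emod_lt_of_pos k hp
  refine Set.mem_iUnion.2 ⟨⟨(k % p).toNat, by omega⟩, shiftPow (k / p) z,
    hX.shiftPow_mem hz _, ?_⟩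
  simp only [substSeq_shiftPow, shiftPow_shiftPow, Int.toNat_of_nonneg hnonneg,
    Int.emod_add_mul_ediv]

theorem isSubshift_substHull [Finite A] [DiscreteTopology A] (hX : IsSubshift X) :
    IsSubshift (substHull τ X) := by
  refine isSubshift_iff.2 ⟨isClosed_iUnion_of_finite fun d => ?_, fun x hx k => ?_⟩
  · exact (hX.1.isCompact.image ((continuous_shiftPow _).comp continuous_substSeq)).isClosed
  · obtain ⟨d, z, hz, rfl⟩ := Set.mem_iUnion.1 hx
    simpa only [shiftPow_shiftPow] using shiftPow_substSeq_mem_substHull hX hz _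

theorem appearsIn_substWord_substHull (hX : IsSubshift X) {w : List A} (hw : AppearsIn w X) :
    AppearsIn (substWord τ w) (substHull τ X) := by
  obtain ⟨z, hz, h⟩ := hw
  refine ⟨substSeq τ z, ?_, h.substWord⟩
  simpa only [shiftPow_zero] using shiftPow_substSeq_mem_substHull hX hz 0

variable [Finite A] [DiscreteTopology A]

theorem substShift_subset_substHull (hp : 2 ≤ p) (hprim : IsPrimitive τ) :
    substShift τ ⊆ substHull τ (substShift τ) := by
  refine Set.sInter_subset_of_mem ⟨isSubshift_substHull (isSubshift_substShift τ), fun n a => ?_⟩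
  obtain ⟨m, hm⟩ := hprim.exists_iterWord_isInfix_succ n a a
  refine AppearsIn.of_isInfix ?_ hm
  rw [iterWord_succ]
  exact appearsIn_substWord_substHull (isSubshift_substShift τ)
    (appearsIn_iterWord_substShift hp hprim m a)

theorem exists_substSeq_eq_shiftPow (hp : 2 ≤ p) (hprim : IsPrimitive τ) (x : substShift τ) :
    ∃ (z : substShift τ) (d : Fin p), substSeq τ z.1 = shiftPow (-((d : ℕ) : ℤ)) x.1 := by
  obtain ⟨d, z, hz, hzx⟩ := Set.mem_iUnion.1 (substShift_subset_substHull hp hprim x.2)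
  refine ⟨⟨z, hz⟩, d, ?_⟩
  simp only [← hzx, shiftPow_shiftPow, neg_add_cancel, shiftPow_zero]

theorem exists_isAddress (hp : 2 ≤ p) (hprim : IsPrimitive τ) (x : substShift τ) :
    ∃ δ, IsAddress τ x δ := by
  choose z d h using exists_substSeq_eq_shiftPow hp hprim
  refine ⟨fun i => d (z^[i] x), fun i => z^[i] x, rfl, fun i => ?_⟩
  simp only [Function.iterate_succ_apply']
  exact h _

theorem isAddress_odometerMap (hp : 2 ≤ p) (hprim : IsPrimitive τ) (x : substShift τ) :
    IsAddress τ x (odometerMap τ x) :=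
  Classical.epsilon_spec (exists_isAddress hp hprim x)

end Address

section Coincidence

variable [TopologicalSpace A] [NeZero p] {τ : A → Fin p → A} {x y : substShift τ}
  {δ : ℕ → Fin p}

theorem IsAddress.exists_tail (h : IsAddress τ x δ) :
    ∃ x' : substShift τ, IsAddress τ x' (fun i => δ (i + 1)) ∧
      ∀ k n, window x.1 (k - (δ 0 : ℕ)) n = window (substSeq τ x'.1) k n := by
  obtain ⟨z, rfl, hz⟩ := h
  refine ⟨z 1, ⟨fun i => z (i + 1), rfl, fun i => hz (i + 1)⟩, fun k n => ?_⟩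
  rw [hz 0, window_shiftPow, sub_eq_add_neg]

theorem tendsto_mul_sub_atTop (d : ℤ) : Tendsto (fun k : ℤ => p * k - d) atTop atTop :=
  tendsto_atTop_add_const_right _ _
    (tendsto_id.const_mul_atTop' (mod_cast NeZero.pos p))

theorem IsAddress.frequently_window_one_eq (hcoin : HasOverallCoincidences τ)
    (hx : IsAddress τ x δ) (hy : IsAddress τ y δ) :
    ∃ᶠ k in atTop, window x.1 k 1 = window y.1 k 1 := by
  obtain ⟨x', -, hxx'⟩ := hx.exists_tail
  obtain ⟨y', -, hyy'⟩ := hy.exists_tail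
  choose j hj using fun k => hcoin (x'.1 k) (y'.1 k)
  have hlim : Tendsto (fun k : ℤ => p * k + (j k : ℕ) - (δ 0 : ℕ)) atTop atTop :=
    tendsto_atTop_mono (fun k => by omega) (tendsto_mul_sub_atTop (p := p) (δ 0 : ℕ))
  refine hlim.frequently (Frequently.of_forall fun k => ?_)
  rw [hxx', hyy', window_one, window_one, substSeq_mul_add, substSeq_mul_add, hj]

theorem IsAddress.frequently_window_pow_eq (hcoin : HasOverallCoincidences τ)
    (hx : IsAddress τ x δ) (hy : IsAddress τ y δ) (m : ℕ) :
    ∃ᶠ k in atTop, window x.1 k (p ^ m) = window y.1 k (p ^ m) := by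
  induction m generalizing x y δ with
  | zero => simpa only [pow_zero] using hx.frequently_window_one_eq hcoin hy
  | succ m ih =>
    obtain ⟨x', hx', hxx'⟩ := hx.exists_tail
    obtain ⟨y', hy', hyy'⟩ := hy.exists_tail
    refine (tendsto_mul_sub_atTop (p := p) (δ 0 : ℕ)).frequently
      ((ih hx' hy').mono fun k hk => ?_)
    rw [hxx', hyy', pow_succ', ← substWord_window, ← substWord_window, hk]

theorem IsAddress.frequently_window_eq (hp : 2 ≤ p) (hcoin : HasOverallCoincidences τ)
    (hx : IsAddress τ x δ) (hy : IsAddress τ y δ) (n : ℕ) :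
    ∃ᶠ k in atTop, window x.1 k n = window y.1 k n := by
  have hn : n ≤ p ^ n := (Nat.lt_pow_self hp).le
  refine (hx.frequently_window_pow_eq hcoin hy n).mono fun k hk => ?_
  exact window_eq_window_iff.2 fun i hki hik => window_eq_window_iff.1 hk i hki (by omega)

end Coincidence

section Proximality

theorem isProximalPair_of_frequently_lt {X : Type*} [PseudoMetricSpace X] {T : X → X} {x y : X}
    (h : ∀ ε > 0, ∃ᶠ n in atTop, dist (T^[n] x) (T^[n] y) < ε) : IsProximalPair dist T x y := by
  have hbdd : IsBoundedUnder (· ≥ ·) atTop fun n => dist (T^[n] x) (T^[n] y) :=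
    isBoundedUnder_of ⟨0, fun n => dist_nonneg⟩
  have hcobdd : IsCoboundedUnder (· ≥ ·) atTop fun n => dist (T^[n] x) (T^[n] y) :=
    IsCoboundedUnder.of_frequently_le ((h 1 one_pos).mono fun n hn => hn.le)
  refine le_antisymm (le_of_forall_pos_le_add fun ε hε => ?_)
    (le_liminf_of_le hcobdd (Eventually.of_forall fun n => dist_nonneg))
  rw [zero_add]
  exact liminf_le_of_frequently_le ((h ε hε).mono fun n hn => hn.le) hbdd

theorem exists_forall_window_eq_imp_dist_lt {X : Type*} [PseudoMetricSpace X] [CompactSpace X]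
    [TopologicalSpace A] [T2Space A] {f : X → ℤ → A} (hf : Continuous f)
    (hinj : Function.Injective f) {ε : ℝ} (hε : 0 < ε) :
    ∃ L : ℕ, ∀ x y, window (f x) (-L) (2 * L) = window (f y) (-L) (2 * L) → dist x y < ε := by
  let E (L : ℕ) : Set (X × X) := {q | ∀ i : ℤ, -L ≤ i → i < L → f q.1 i = f q.2 i}
  have hE : Antitone E := fun L M hLM q hq i hi hi' => hq i (by omega) (by omega)
  have hclosed (L : ℕ) : IsClosed (E L) := by
    simp only [E, Set.ofPred_forall]
    exact isClosed_iInter fun i => isClosed_iInter fun _ => isClosed_iInter fun _ =>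
      isClosed_eq (by fun_prop) (by fun_prop)
  have hdiag (q : X × X) (hq : q ∈ ⋂ L, E L) : {q : X × X | dist q.1 q.2 < ε} ∈ 𝓝 q := by
    have heq : q.1 = q.2 := hinj <| funext fun i =>
      Set.mem_iInter.1 hq (i.natAbs + 1) i (by omega) (by omega)
    refine (isOpen_lt continuous_dist continuous_const).mem_nhds ?_
    rwa [Set.mem_ofPred_eq, heq, dist_self]
  obtain ⟨L, hL⟩ := exists_subset_nhds_of_compactSpace hE.directed_ge hclosed hdiag
  refine ⟨L, fun x y hxy => @hL (x, y) fun i hi hi' => ?_⟩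
  exact window_eq_window_iff.1 hxy i hi (by omega)

end Proximality

end ConstSubst

open ConstSubst Filter in
theorem proposition3p3_general {A : Type*} [Finite A] [TopologicalSpace A] [DiscreteTopology A]
    {p : ℕ} [NeZero p] (hp : 2 ≤ p) {τ : A → Fin p → A} (hcoin : HasOverallCoincidences τ)
    (ρ : MetricSpace (substShift τ))
    (hρ : ρ.toUniformSpace.toTopologicalSpace =
      (instTopologicalSpaceSubtype : TopologicalSpace (substShift τ)))
    {x y : substShift τ} {δ : ℕ → Fin p} (hx : IsAddress τ x δ) (hy : IsAddress τ y δ) :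
    IsProximalPair ρ.dist (shiftOn τ) x y := by
  have : CompactSpace (substShift τ) :=
    isCompact_iff_compactSpace.1 (isClosed_substShift τ).isCompact
  let _ := ρ.replaceTopology hρ.symm
  refine isProximalPair_of_frequently_lt fun ε hε => ?_
  have hval : Continuous (Subtype.val : substShift τ → ℤ → A) := continuous_subtype_val
  obtain ⟨L, hL⟩ := exists_forall_window_eq_imp_dist_lt hval Subtype.val_injective hε
  have hlim : Tendsto (fun k : ℤ => k.toNat + L) atTop atTop :=
    tendsto_atTop.2 fun n => (eventually_ge_atTop (n : ℤ)).mono fun k hk => by omega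
  refine hlim.frequently <| ((hx.frequently_window_eq hp hcoin hy (2 * L)).and_eventually
    (eventually_ge_atTop 0)).mono fun k ⟨hk, hk0⟩ => hL _ _ ?_
  have hshift : -(L : ℤ) + (k.toNat + L : ℕ) = k := by
    rw [Nat.cast_add, Int.toNat_of_nonneg hk0, neg_add_cancel_comm_assoc]
  rw [coe_shiftOn_iterate, coe_shiftOn_iterate, window_shiftPow, window_shiftPow, hshift, hk]

theorem proposition3p3 {A : Type*} [Finite A] [TopologicalSpace A] [DiscreteTopology A]
    {p : ℕ} [NeZero p] (hp : 2 ≤ p) (τ : A → Fin p → A)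
    (hprim : ConstSubst.IsPrimitive τ)
    (hinf : (ConstSubst.substShift τ).Infinite)
    (hcoin : ConstSubst.HasOverallCoincidences τ)
    (ρ : MetricSpace (ConstSubst.substShift τ))
    (hρ : ρ.toUniformSpace.toTopologicalSpace =
      (instTopologicalSpaceSubtype : TopologicalSpace (ConstSubst.substShift τ)))
    (x y : ConstSubst.substShift τ) (hxy : x ≠ y)
    (hπ : ConstSubst.odometerMap τ x = ConstSubst.odometerMap τ y) :
    ConstSubst.IsProximalPair ρ.dist (ConstSubst.shiftOn τ) x y :=
  proposition3p3_general hp hcoin ρ hρ (ConstSubst.isAddress_odometerMap hp hprim x)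
    (hπ ▸ ConstSubst.isAddress_odometerMap hp hprim y)
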